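/- Define $A,B:\mathbb{N}\times\mathbb{N}\to\mathbb{N}$ by $A(0,n)=2n$, $B(0,n)=n^2$ and, for $k\ge 1$, $A(k,0)=1$, $B(k,0)=2$, $A(k,n)=A(k-1,A(k,n-1))$ and $B(k,n)=B(k-1,B(k,n-1))$ for $n\ge 1$. Let $\alpha_{2k}(n)=\min\{s\ge 0: A(k,s)\ge n\}$ and $\alpha_{2k+1}(n)=\min\{s\ge 0: B(k,s)\ge n\}$. The uniform line metric with $n$ points is the set $\{1,\dots,n\}\subset\mathbb{Z}$ with the distance $|a-b|$. A (Steiner) $t$-spanner with hop-diameter $k$ for it is a graph $H$ on the vertex set $\mathbb{Z}$ (so arbitrary integers may serve as Steiner points), each edge $\{a,b\}$ having weight $|a-b|$, such that any two distinct $p,q\in\{1,\dots,n\}$ are joined in $H$ by a path with at most $k$ edges and of total weight at most $t\,|p-q|$. Theorem. (1) There is an absolute constant $c>0$ such that for all integers $n\ge 1$ and $k\ge 2$ and all real $\varepsilon\in[0,1/2]$, every (Steiner) $(1+\varepsilon)$-spanner with hop-diameter $k$ for the uniform line metric with $n$ points has at least $c\cdot\frac{n}{2^{6\lfloor k/2\rfloor}}\,\alpha_k(n)$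 edges. (2) For every constant $k$ this is tight up to a constant factor: for every integer $k\ge 2$ there is a constant $C_k>0$ such that for every $n\ge 3$ there is a $1$-spanner with hop-diameter $k$ for the uniform line metric with $n$ points that uses no Steiner points and has at most $C_k\, n\,\alpha_k(n)$ edges. -/

import Mathlib

namespace HopSpanner

/-- The weight of a walk in a geometric graph: the sum of the distances between the endpoints of
its edges (with multiplicity). -/
noncomputable def walkWeight {V : Type*} [MetricSpace V] {H : SimpleGraph V} {p q : V}
    (w : H.Walk p q) : ℝ :=
  (w.darts.map fun d => dist d.fst d.snd).sum

/-- `H` is a (Steiner) `t`-spanner with hop-diameter `k` for the set `S` of points of the metric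
space `V`: every two distinct points of `S` are joined in `H` by a path that has weight at most
`t` times their distance and that consists of at most `k` edges.
All points of `V` are available as vertices of `H`, so that the points outside `S` that `H` uses
are Steiner points. Since removing cycles from a walk increases neither the weight nor the number
of edges, it makes no difference whether walks or paths are used. -/
def IsSpanner {V : Type*} [MetricSpace V] (S : Set V) (t : ℝ) (k : ℕ) (H : SimpleGraph V) :
    Prop :=
  ∀ p ∈ S, ∀ q ∈ S, p ≠ q → ∃ w : H.Walk p q, walkWeight w ≤ t * dist p q ∧ w.length ≤ k

/-- The points `1, …, n` of the uniform line metric, which is `ℤ` with the distance `|a - b|`. -/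
def uniformLine (n : ℕ) : Set ℤ := Set.Icc 1 (n : ℤ)

/-- The Ackermann-type function `A(k, n)`. -/
def ackA : ℕ → ℕ → ℕ
  | 0, n => 2 * n
  | _ + 1, 0 => 1
  | k + 1, n + 1 => ackA k (ackA (k + 1) n)

/-- The Ackermann-type function `B(k, n)`. -/
def ackB : ℕ → ℕ → ℕ
  | 0, n => n ^ 2
  | _ + 1, 0 => 2
  | k + 1, n + 1 => ackB k (ackB (k + 1) n)

theorem lt_ackA_succ (k : ℕ) : ∀ n, n < ackA (k + 1) n ∧ (∀ m, 1 ≤ m → m < ackA k m) := by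
  induction k with
  | zero =>
    have h : ∀ m, 1 ≤ m → m < ackA 0 m := by
      intro m hm; rw [ackA]; omega
    intro n
    refine ⟨?_, h⟩
    induction n with
    | zero => simp [ackA]
    | succ n ih =>
      rw [ackA]
      have := h (ackA (0 + 1) n) (by omega)
      omega
  | succ k ih =>
    have h : ∀ m, 1 ≤ m → m < ackA (k + 1) m := fun m _ => (ih m).1
    intro n
    refine ⟨?_, h⟩
    induction n with
    | zero => simp [ackA]
    | succ n ih' =>
      rw [ackA]
      have := h (ackA (k + 1 + 1) n) (by omega)
      omega

theorem lt_ackB_succ (k : ℕ) : ∀ n, n + 1 < ackB (k + 1) n ∧ (∀ m, 2 ≤ m → m < ackB k m) := by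
  induction k with
  | zero =>
    have h : ∀ m, 2 ≤ m → m < ackB 0 m := by
      intro m hm; rw [ackB]; nlinarith
    intro n
    refine ⟨?_, h⟩
    induction n with
    | zero => simp [ackB]
    | succ n ih =>
      rw [ackB]
      have := h (ackB (0 + 1) n) (by omega)
      omega
  | succ k ih =>
    have h : ∀ m, 2 ≤ m → m < ackB (k + 1) m := fun m _ => by
      have := (ih m).1
      omega
    intro n
    refine ⟨?_, h⟩
    induction n with
    | zero => simp [ackB]
    | succ n ih' =>
      rw [ackB]
      have := h (ackB (k + 1 + 1) n) (by omega)
      omega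

theorem exists_le_ackA (k n : ℕ) : ∃ s, n ≤ ackA k s :=
  ⟨n + 1, by have := (lt_ackA_succ k 0).2 (n + 1) (by omega); omega⟩

theorem exists_le_ackB (k n : ℕ) : ∃ s, n ≤ ackB k s :=
  ⟨n + 2, by have := (lt_ackB_succ k 0).2 (n + 2) (by omega); omega⟩

open Classical in
/-- The inverse function `α_k(n)`: the least `s ≥ 0` with `A(k / 2, s) ≥ n` if `k` is even, and
the least `s ≥ 0` with `B((k - 1) / 2, s) ≥ n` if `k` is odd. -/
noncomputable def alpha (k n : ℕ) : ℕ :=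
  if Even k then Nat.find (exists_le_ackA (k / 2) n) else Nat.find (exists_le_ackB (k / 2) n)

end HopSpanner

/-! Lower bound. In a spanner with `ε ≤ 1/2` a path from `p` to `q` strays little from `[p, q]`;
`LocallyLinked` keeps just this, in a form that survives contraction. Cut `5 * l * b` points into
blocks of length `b`. Two points in different blocks that touch no cross-block edge are linked by a
path whose first and last steps stay inside their blocks, so contracting blocks saves two hops.
Hence either many points touch cross edges, or most of the `l` middle blocks contain an untouched
point and the bound for `k` hops applies to the blocks. With `l` chosen so that this bound gives `c
* b` pairs per block, there are order `c` cross pairs per point either way (`card_cross_ge`). Each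
further subdivision level adds as much, so `s` levels cost order `s` per point (`LinkBound.step`).
The lengths this needs grow no faster than the Ackermann hierarchy, up to a linear change of
argument (`stepLength_le`).

Upper bound. The same recursion is run as a construction (`HasHopGraph.step`): each point is joined
to the neighbouring block boundaries, the boundaries carry a `k`-hop graph, and the blocks are
treated recursively. Both recursions start from zero hops (giving `ackA`) and one hop (giving
`ackB`). -/

namespace HopSpanner

/-! ### Paths as bounded chains of steps -/

/-- `q` is reached from `p` by at most `k` steps of the relation `R`. -/
def Hop {V : Type*} (R : V → V → Prop) : ℕ → V → V → Prop
  | 0, p, q => p = q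
  | k + 1, p, q => ∃ r, (p = r ∨ R p r) ∧ Hop R k r q

section Hop

variable {V W : Type*} {R : V → V → Prop} {R' : W → W → Prop}

theorem Hop.refl (k : ℕ) (p : V) : Hop R k p p := by
  induction k with
  | zero => rfl
  | succ k ih => exact ⟨p, Or.inl rfl, ih⟩

/-- Since a step may stand still, a map is allowed to collapse steps; this is what makes contraction
of blocks work. -/
theorem Hop.map (f : V → W) (hf : ∀ x y, R x y → f x = f y ∨ R' (f x) (f y)) {k : ℕ} {p q : V}
    (h : Hop R k p q) : Hop R' k (f p) (f q) := by
  induction k generalizing p with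
  | zero => exact congrArg f h
  | succ k ih =>
    obtain ⟨r, h1, h2⟩ := h
    refine ⟨f r, ?_, ih h2⟩
    rcases h1 with rfl | h1
    · exact Or.inl rfl
    · exact hf _ _ h1

theorem Hop.mono {Q : V → V → Prop} (hf : ∀ x y, R x y → Q x y) {k : ℕ} {p q : V}
    (h : Hop R k p q) : Hop Q k p q :=
  Hop.map id (fun x y hxy => Or.inr (hf x y hxy)) h

theorem Hop.trans {k l : ℕ} {p q r : V} (h : Hop R k p q) (h' : Hop R l q r) :
    Hop R (k + l) p r := by
  induction k generalizing p with
  | zero => cases h; simpa using h'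
  | succ k ih =>
    obtain ⟨t, h1, h2⟩ := h
    rw [Nat.succ_add]
    exact ⟨t, h1, ih h2⟩

theorem Hop.of_le {k l : ℕ} (hkl : k ≤ l) {p q : V} (h : Hop R k p q) : Hop R l p q := by
  obtain ⟨m, rfl⟩ := Nat.exists_eq_add_of_le hkl
  exact h.trans (Hop.refl m q)

theorem Hop.single {p q : V} (h : p = q ∨ R p q) : Hop R 1 p q := ⟨q, h, rfl⟩

theorem Hop.exists_last {k : ℕ} {p q : V} (h : Hop R (k + 1) p q) :
    ∃ r, Hop R k p r ∧ (r = q ∨ R r q) := by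
  induction k generalizing p with
  | zero =>
    obtain ⟨r, h1, h2⟩ := h
    cases h2
    exact ⟨p, rfl, h1⟩
  | succ k ih =>
    obtain ⟨r, h1, h2⟩ := h
    obtain ⟨t, h3, h4⟩ := ih h2
    exact ⟨t, ⟨r, h1, h3⟩, h4⟩

end Hop

/-! ### Local linkage and the base cases of zero and one hop -/

open Classical in
/-- The pairs of points of `[a, a + n)` that are related by `R`. -/
noncomputable def relPairs (R : ℤ → ℤ → Prop) (a : ℤ) (n : ℕ) : Finset (ℤ × ℤ) :=
  (Finset.Ico a (a + n) ×ˢ Finset.Ico a (a + n)).filter fun e => R e.1 e.2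

theorem mem_relPairs {R : ℤ → ℤ → Prop} {a : ℤ} {n : ℕ} {e : ℤ × ℤ} :
    e ∈ relPairs R a n ↔
      ((a ≤ e.1 ∧ e.1 < a + n) ∧ (a ≤ e.2 ∧ e.2 < a + n)) ∧ R e.1 e.2 := by
  simp [relPairs]

/-- The points that a path from `p` to `q` may use. -/
def Near (p q x : ℤ) : Prop := 2 * p - q - 2 ≤ x ∧ x ≤ 2 * q - p + 2

/-- Any two points of `S` are joined by at most `k` steps of `R` that stay near the two points. -/
def LocallyLinked (R : ℤ → ℤ → Prop) (S : Finset ℤ) (k : ℕ) : Prop :=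
  ∀ p ∈ S, ∀ q ∈ S, p < q → Hop (fun x y => R x y ∧ Near p q x ∧ Near p q y) k p q

/-- On intervals of length `n`, a relation that links locally all points of `S` by `k` steps has
at least `d` pairs per point, up to a penalty of `K` for each point missing in `S`. -/
def LinkBoundAt (k n : ℕ) (d K : ℝ) : Prop :=
  ∀ (a : ℤ) (R : ℤ → ℤ → Prop) (S : Finset ℤ), S ⊆ Finset.Ico a (a + n) →
    LocallyLinked R S k → d * (n - K * (n - S.card)) ≤ ((relPairs R a n).card : ℝ)

/-- A linear family of lower bounds: `c * s` pairs per point on intervals of length `L s`. -/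
def LinkBound (k : ℕ) (L : ℕ → ℕ) (c K : ℝ) : Prop :=
  ∀ s : ℕ, LinkBoundAt k (L s) (c * s) K

theorem LocallyLinked.subset {R : ℤ → ℤ → Prop} {S T : Finset ℤ} {k : ℕ}
    (h : LocallyLinked R S k) (hT : T ⊆ S) : LocallyLinked R T k :=
  fun p hp q hq hpq => h p (hT hp) q (hT hq) hpq

/-- Zero hops link no two distinct points, so `S` misses at least one of the two points and the
penalty 2 cancels the bound, however large the density. -/
theorem linkBound_zero : LinkBound 0 (fun _ => 2) (1 / 4) 2 := by
  intro s a R S _ hR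
  have hS : S.card ≤ 1 := by
    rw [Finset.card_le_one]
    intro p hp q hq
    rcases lt_trichotomy p q with h | h | h
    · exact hR p hp q hq h
    · exact h
    · exact (hR q hq p hp h).symm
  have hS' : (S.card : ℝ) ≤ 1 := by exact_mod_cast hS
  have : (0 : ℝ) ≤ (relPairs R a 2).card := by positivity
  have h2 : (1 / 4 : ℝ) * s * ((2 : ℕ) - 2 * ((2 : ℕ) - S.card)) ≤ 0 := by
    apply mul_nonpos_of_nonneg_of_nonpos (by positivity)
    push_cast
    linarith
  exact h2.trans this

theorem card_filter_lt_offDiag (S : Finset ℤ) :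
    2 * (S.offDiag.filter fun e => e.1 < e.2).card = S.card * S.card - S.card := by
  rw [← Finset.offDiag_card]
  have h := Finset.card_filter_add_card_filter_not (s := S.offDiag) (fun e => e.1 < e.2)
  have h2 : (S.offDiag.filter fun e => ¬ e.1 < e.2).card
      = (S.offDiag.filter fun e => e.1 < e.2).card := by
    refine Finset.card_bij' (fun e _ => e.swap) (fun e _ => e.swap) ?_ ?_ (by simp) (by simp)
    · intro e he
      simp only [Finset.mem_filter, Finset.mem_offDiag, Prod.fst_swap, Prod.snd_swap] at he ⊢
      exact ⟨⟨he.1.2.1, he.1.1, he.1.2.2.symm⟩, by have := he.1.2.2; omega⟩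
    · intro e he
      simp only [Finset.mem_filter, Finset.mem_offDiag, Prod.fst_swap, Prod.snd_swap] at he ⊢
      exact ⟨⟨he.1.2.1, he.1.1, he.1.2.2.symm⟩, by omega⟩
  omega

/-- One hop forces every increasing pair of points of `S` to be related, which gives quadratically
many pairs. -/
theorem linkBound_one : LinkBound 1 (fun s => s + 2) (1 / 4) 2 := by
  intro s a R S hS hR
  have hsub : (S.offDiag.filter fun e => e.1 < e.2) ⊆ relPairs R a (s + 2) := by
    intro e he
    simp only [Finset.mem_filter, Finset.mem_offDiag] at he
    have h1 := Finset.mem_Ico.1 (hS he.1.1)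
    have h2 := Finset.mem_Ico.1 (hS he.1.2.1)
    refine mem_relPairs.2 ⟨⟨h1, h2⟩, ?_⟩
    obtain ⟨r, h3, h4⟩ := hR _ he.1.1 _ he.1.2.1 he.2
    cases h4
    rcases h3 with h3 | h3
    · exact absurd h3 he.1.2.2
    · exact h3.1
  have hcard := Finset.card_le_card hsub
  have h2 := card_filter_lt_offDiag S
  have hm : S.card ≤ s + 2 := by
    have := Finset.card_le_card hS
    rw [Int.card_Ico] at this
    push_cast at this
    omega
  have hle : S.card ≤ S.card * S.card := Nat.le_mul_self _
  have h3 : (S.card : ℝ) * S.card - S.card ≤ 2 * (relPairs R a (s + 2)).card := by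
    have : S.card * S.card ≤ 2 * (relPairs R a (s + 2)).card + S.card := by omega
    have : (S.card : ℝ) * S.card ≤ 2 * (relPairs R a (s + 2)).card + S.card := by exact_mod_cast this
    linarith
  have hm' : (S.card : ℝ) ≤ s + 2 := by exact_mod_cast hm
  have hs : (0 : ℝ) ≤ s := by positivity
  push_cast
  rcases le_or_gt (2 * S.card) (s + 2) with h | h
  · have h' : (2 : ℝ) * S.card ≤ s + 2 := by exact_mod_cast h
    have : (1 / 4 : ℝ) * s * ((s : ℝ) + 2 - 2 * (s + 2 - S.card)) ≤ 0 :=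
      mul_nonpos_of_nonneg_of_nonpos (by positivity) (by linarith)
    exact this.trans (by positivity)
  · have h' : (s : ℝ) + 3 ≤ 2 * S.card := by exact_mod_cast h
    nlinarith [mul_nonneg hs (sub_nonneg.2 hm'), mul_nonneg (Nat.cast_nonneg (α := ℝ) S.card)
      (sub_nonneg.2 h')]

/-! ### Blocks, contraction and the recursive lower bound -/

/-- The index of the block of length `b` that contains `x`, for blocks starting from `a`. -/
def blockIndex (a : ℤ) (b : ℕ) (x : ℤ) : ℤ := (x - a) / b

theorem blockIndex_eq_iff {a : ℤ} {b : ℕ} (hb : 0 < b) {x i : ℤ} :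
    blockIndex a b x = i ↔ a + i * b ≤ x ∧ x < a + i * b + b := by
  have hb' : (0 : ℤ) < b := by exact_mod_cast hb
  rw [blockIndex, le_antisymm_iff, ← Int.lt_add_one_iff, Int.ediv_lt_iff_lt_mul hb',
    Int.le_ediv_iff_mul_le hb', add_mul]
  constructor <;> rintro ⟨h1, h2⟩ <;> constructor <;> linarith

theorem sum_card_relPairs_add_card_cross_le (R : ℤ → ℤ → Prop) (a : ℤ) {b : ℕ} (hb : 0 < b)
    (m : ℕ) :
    ∑ i ∈ Finset.Ico (0 : ℤ) m, (relPairs R (a + i * b) b).card +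
      ((relPairs R a (m * b)).filter fun e => blockIndex a b e.1 ≠ blockIndex a b e.2).card ≤
      (relPairs R a (m * b)).card := by
  have hb' : (0 : ℤ) < b := by exact_mod_cast hb
  rw [← Finset.card_filter_add_card_filter_not (s := relPairs R a (m * b))
    (fun e => blockIndex a b e.1 = blockIndex a b e.2)]
  refine Nat.add_le_add_right ?_ _
  have hdis : (Finset.Ico (0 : ℤ) m : Set ℤ).PairwiseDisjoint
      fun i => relPairs R (a + i * b) b := by
    intro i _ j _ hij
    refine Finset.disjoint_left.2 fun e he he' => hij ?_
    rw [mem_relPairs] at he he'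
    rw [← (blockIndex_eq_iff hb).2 he.1.1, ← (blockIndex_eq_iff hb).2 he'.1.1]
  rw [← Finset.card_biUnion hdis]
  refine Finset.card_le_card fun e he => ?_
  obtain ⟨i, hi, he⟩ := Finset.mem_biUnion.1 he
  rw [Finset.mem_Ico] at hi
  rw [mem_relPairs] at he
  have h0 : 0 ≤ i * (b : ℤ) := mul_nonneg hi.1 hb'.le
  have h1 : (i + 1) * (b : ℤ) ≤ m * b := mul_le_mul_of_nonneg_right (by omega) hb'.le
  rw [add_mul, one_mul] at h1
  refine Finset.mem_filter.2 ⟨mem_relPairs.2 ⟨?_, he.2⟩, ?_⟩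
  · push_cast
    refine ⟨⟨?_, ?_⟩, ?_, ?_⟩ <;> linarith [he.1.1.1, he.1.1.2, he.1.2.1, he.1.2.2]
  · rw [(blockIndex_eq_iff hb).2 he.1.1, (blockIndex_eq_iff hb).2 he.1.2]

/-- Lower bounds on blocks add up. -/
theorem LinkBoundAt.blocks {k b : ℕ} {d K : ℝ} (h : LinkBoundAt k b d K)
    (hL : 0 < b) (a : ℤ) (m : ℕ) (R : ℤ → ℤ → Prop) (S : Finset ℤ)
    (hS : S ⊆ Finset.Ico a (a + (m * b : ℕ))) (hR : LocallyLinked R S k) :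
    d * ((m * b : ℕ) - K * ((m * b : ℕ) - S.card)) +
      ((relPairs R a (m * b)).filter fun e => blockIndex a b e.1 ≠ blockIndex a b e.2).card ≤
      ((relPairs R a (m * b)).card : ℝ) := by
  have hb' : (0 : ℤ) < b := by exact_mod_cast hL
  have hsum := sum_card_relPairs_add_card_cross_le R a hL m
  have hmap : ∀ x ∈ S, blockIndex a b x ∈ Finset.Ico (0 : ℤ) m := by
    intro x hx
    have := Finset.mem_Ico.1 (hS hx)
    push_cast at this
    rw [Finset.mem_Ico, blockIndex, Int.ediv_lt_iff_lt_mul hb', Int.le_ediv_iff_mul_le hb']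
    constructor <;> linarith [this.1, this.2]
  have hcard := Finset.card_eq_sum_card_fiberwise hmap
  have hblock : ∀ i ∈ Finset.Ico (0 : ℤ) m,
      d * (b - K * (b - (S.filter fun x => blockIndex a b x = i).card)) ≤
        ((relPairs R (a + i * b) b).card : ℝ) := by
    intro i _
    refine h (a + i * b) R _ ?_ (hR.subset (Finset.filter_subset _ _))
    intro x hx
    rw [Finset.mem_Ico]
    exact (blockIndex_eq_iff hL).1 (Finset.mem_filter.1 hx).2
  have h1 := Finset.sum_le_sum hblock
  have h2 : ∑ i ∈ Finset.Ico (0 : ℤ) m,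
      d * (b - K * (b - ((S.filter fun x => blockIndex a b x = i).card : ℝ))) =
      d * ((m * b : ℕ) - K * ((m * b : ℕ) - S.card)) := by
    rw [← Finset.mul_sum, Finset.sum_sub_distrib, ← Finset.mul_sum, Finset.sum_sub_distrib,
      hcard]
    simp
  rw [h2] at h1
  have h3 : (∑ i ∈ Finset.Ico (0 : ℤ) m, ((relPairs R (a + i * b) b).card : ℝ)) +
      ((relPairs R a (m * b)).filter fun e => blockIndex a b e.1 ≠ blockIndex a b e.2).card ≤
      ((relPairs R a (m * b)).card : ℝ) := by exact_mod_cast hsum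
  linarith

/-- Contracting blocks: the points without edges to other blocks need two steps to leave their
block and to enter another one. -/
theorem LocallyLinked.contract {R : ℤ → ℤ → Prop} {a : ℤ} {b l k : ℕ} (hb : 0 < b)
    {S : Finset ℤ} (hR : LocallyLinked R S (k + 2)) {cross : Finset (ℤ × ℤ)}
    (hcross : ∀ e, e ∈ cross ↔ e ∈ relPairs R a (5 * l * b) ∧
      blockIndex a b e.1 ≠ blockIndex a b e.2)
    {T : Finset ℤ} (hT : ∀ i ∈ T, (2 * l ≤ i ∧ i < 3 * l) ∧ ∃ p ∈ S, blockIndex a b p = i ∧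
      ∀ e ∈ cross, e.1 ≠ p ∧ e.2 ≠ p) :
    LocallyLinked (fun i j => ∃ e ∈ cross, blockIndex a b e.1 = i ∧ blockIndex a b e.2 = j)
      T k := by
  intro i hi j hj hij
  obtain ⟨⟨hi1, hi2⟩, p, hpS, hpi, hpe⟩ := hT i hi
  obtain ⟨⟨hj1, hj2⟩, q, hqS, hqj, hqe⟩ := hT j hj
  have hb' : (0 : ℤ) < b := by exact_mod_cast hb
  have hpi' := (blockIndex_eq_iff hb).1 hpi
  have hqj' := (blockIndex_eq_iff hb).1 hqj
  have m1 : (2 * l : ℤ) * b ≤ i * b := mul_le_mul_of_nonneg_right hi1 hb'.le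
  have m2 : (j + 1 : ℤ) * b ≤ 3 * l * b := mul_le_mul_of_nonneg_right (by omega) hb'.le
  have m3 : (i + 1 : ℤ) * b ≤ j * b := mul_le_mul_of_nonneg_right (by omega) hb'.le
  have hpq : p < q := by linarith [hpi'.2, hqj'.1]
  -- As `p` and `q` lie in the middle fifth, `q - p < l * b`, so the linking path cannot leave the
  -- whole interval.
  have hin : ∀ x, Near p q x → a ≤ x ∧ x < a + (5 * l * b : ℕ) := by
    intro x hx
    have m4 : (0 : ℤ) ≤ l * b := by positivity
    have hl : (1 : ℤ) ≤ l := by omega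
    have m5 : (1 : ℤ) * b ≤ l * b := mul_le_mul_of_nonneg_right hl hb'.le
    push_cast
    constructor <;> nlinarith [hx.1, hx.2, hpi'.1, hpi'.2, hqj'.1, hqj'.2]
  -- The additive slack 2 in `Near` absorbs the rounding to block indices, so nearness is preserved
  -- by contraction.
  have hnear : ∀ x, Near p q x → Near i j (blockIndex a b x) := by
    intro x hx
    obtain ⟨h1, h2⟩ := hx
    constructor
    · rw [blockIndex, Int.le_ediv_iff_mul_le hb']
      nlinarith [hpi'.1, hqj'.2]
    · rw [← Int.lt_add_one_iff, blockIndex, Int.ediv_lt_iff_lt_mul hb']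
      nlinarith [hpi'.1, hqj'.2]
  have hmem : ∀ x y, R x y ∧ Near p q x ∧ Near p q y → blockIndex a b x ≠ blockIndex a b y →
      (x, y) ∈ cross := fun x y h hne =>
    (hcross _).2 ⟨mem_relPairs.2 ⟨⟨hin x h.2.1, hin y h.2.2⟩, h.1⟩, hne⟩
  -- As `p` and `q` touch no cross pair, the first and last steps stay in their blocks; the `k`
  -- steps between them survive as steps between blocks.
  obtain ⟨r, h1, h2⟩ := hR p hpS q hqS hpq
  obtain ⟨t, h3, h4⟩ := h2.exists_last
  have hr : blockIndex a b r = i := by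
    rcases h1 with rfl | h1
    · exact hpi
    · by_contra hne
      exact (hpe _ (hmem p r h1 fun h => hne (h ▸ hpi))).1 rfl
  have ht : blockIndex a b t = j := by
    rcases h4 with rfl | h4
    · exact hqj
    · by_contra hne
      exact (hqe _ (hmem t q h4 fun h => hne (h.trans hqj))).2 rfl
  rw [← hr, ← ht]
  refine h3.map (blockIndex a b) fun x y hxy => ?_
  rcases eq_or_ne (blockIndex a b x) (blockIndex a b y) with h | h
  · exact Or.inl h
  · refine Or.inr ⟨⟨(x, y), hmem x y hxy h, rfl, rfl⟩, ?_⟩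
    rw [hr, ht]
    exact ⟨hnear x hxy.2.1, hnear y hxy.2.2⟩

/-- Let `X` be the number of cross pairs and `M` the number of points missing from `S`. The
contracted bound reads `X ≥ c * b * (l - K * (l - |T|))` for the set `T` of middle blocks with an
untouched point, and covering the middle fifth gives `(l - |T|) * b ≤ M + 2 * X`. With `c * K ≤ 1/2`
the term in `X` is absorbed: `2 * X ≥ c * l * b - c * K * M`. -/
theorem card_cross_ge {R : ℤ → ℤ → Prop} {a : ℤ} {b l k : ℕ} (hb : 0 < b) {c K : ℝ}
    (hc : 0 ≤ c) (hK : 0 ≤ K) (hcK : c * K ≤ 1 / 2) (h : LinkBoundAt k l (c * b) K)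
    {S : Finset ℤ} (hS : S ⊆ Finset.Ico a (a + (5 * l * b : ℕ)))
    (hR : LocallyLinked R S (k + 2)) :
    c / 10 * ((5 * l * b : ℕ) - 5 * K * ((5 * l * b : ℕ) - S.card)) ≤
      (((relPairs R a (5 * l * b)).filter
        fun e => blockIndex a b e.1 ≠ blockIndex a b e.2).card : ℝ) := by
  classical
  set cross := (relPairs R a (5 * l * b)).filter
        fun e => blockIndex a b e.1 ≠ blockIndex a b e.2 with hcrossdef
  have hcross : ∀ e, e ∈ cross ↔ e ∈ relPairs R a (5 * l * b) ∧
      blockIndex a b e.1 ≠ blockIndex a b e.2 := fun e => by rw [hcrossdef, Finset.mem_filter]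
  set G := cross.image Prod.fst ∪ cross.image Prod.snd with hG
  have hGcard : G.card ≤ 2 * cross.card := by
    have h1 := Finset.card_union_le (cross.image Prod.fst) (cross.image Prod.snd)
    have h2 : (cross.image Prod.fst).card ≤ _ := Finset.card_image_le
    have h3 : (cross.image Prod.snd).card ≤ _ := Finset.card_image_le
    rw [← hG] at h1
    omega
  have hGmem : ∀ p, p ∉ G → ∀ e ∈ cross, e.1 ≠ p ∧ e.2 ≠ p := by
    intro p hp e he
    rw [hG, Finset.mem_union, not_or] at hp
    exact ⟨fun h => hp.1 (Finset.mem_image.2 ⟨e, he, h⟩),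
      fun h => hp.2 (Finset.mem_image.2 ⟨e, he, h⟩)⟩
  set T := ((S.filter (· ∉ G)).image (blockIndex a b)).filter
    fun i => 2 * (l : ℤ) ≤ i ∧ i < 3 * l with hTdef
  have hT : ∀ i, i ∈ T ↔ (∃ p ∈ S, p ∉ G ∧ blockIndex a b p = i) ∧ 2 * (l : ℤ) ≤ i ∧ i < 3 * l := by
    intro i
    simp only [hTdef, Finset.mem_filter, Finset.mem_image, and_assoc]
  have hlink := hR.contract (a := a) (l := l) hb hcross (T := T) (by
    intro i hi
    obtain ⟨⟨p, h1, h2, h3⟩, h4⟩ := (hT i).1 hi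
    exact ⟨h4, p, h1, h3, hGmem p h2⟩)
  have hlow := h (2 * l) _ T (by
    intro i hi
    have := ((hT i).1 hi).2
    rw [Finset.mem_Ico]
    omega) hlink
  have hcard : ((relPairs (fun i j => ∃ e ∈ cross, blockIndex a b e.1 = i ∧
      blockIndex a b e.2 = j) (2 * l) l).card : ℝ) ≤ cross.card := by
    have : relPairs (fun i j => ∃ e ∈ cross, blockIndex a b e.1 = i ∧
        blockIndex a b e.2 = j) (2 * l) l ⊆
        cross.image fun e => (blockIndex a b e.1, blockIndex a b e.2) := by
      intro f hf
      obtain ⟨e, he, h1, h2⟩ := (mem_relPairs.1 hf).2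
      exact Finset.mem_image.2 ⟨e, he, Prod.ext h1 h2⟩
    exact_mod_cast (Finset.card_le_card this).trans Finset.card_image_le
  -- A point of the middle fifth is missing from `S`, touches a cross pair, or lies in a block of
  -- `T`.
  have hcover : Finset.Ico (a + (2 * l * b : ℕ)) (a + (3 * l * b : ℕ)) ⊆
      ((Finset.Ico a (a + (5 * l * b : ℕ)) \ S) ∪ G) ∪
        T.biUnion fun i => Finset.Ico (a + i * b) (a + i * b + b) := by
    intro x hx
    rw [Finset.mem_Ico] at hx
    have hb' : (0 : ℤ) < b := by exact_mod_cast hb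
    have hlb : (0 : ℤ) ≤ l * b := by positivity
    push_cast at hx
    by_cases hxS : x ∈ S
    · by_cases hxG : x ∈ G
      · simp [hxG]
      · refine Finset.mem_union_right _ (Finset.mem_biUnion.2 ⟨blockIndex a b x, ?_, ?_⟩)
        · refine (hT _).2 ⟨⟨x, hxS, hxG, rfl⟩, ?_⟩
          rw [blockIndex, Int.ediv_lt_iff_lt_mul hb', Int.le_ediv_iff_mul_le hb']
          constructor <;> linarith [hx.1, hx.2]
        · rw [Finset.mem_Ico]
          exact (blockIndex_eq_iff hb).1 rfl
    · refine Finset.mem_union_left _ (Finset.mem_union_left _ (Finset.mem_sdiff.2 ⟨?_, hxS⟩))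
      rw [Finset.mem_Ico]
      push_cast
      constructor <;> linarith [hx.1, hx.2]
  have hcount : l * b + S.card ≤ 5 * l * b + 2 * cross.card + T.card * b := by
    have h1 := Finset.card_le_card hcover
    have h2 := Finset.card_union_le ((Finset.Ico a (a + (5 * l * b : ℕ)) \ S) ∪ G)
      (T.biUnion fun i => Finset.Ico (a + i * b) (a + i * b + b))
    have h3 := Finset.card_union_le (Finset.Ico a (a + (5 * l * b : ℕ)) \ S) G
    have h4 : (T.biUnion fun i => Finset.Ico (a + i * (b : ℤ)) (a + i * b + b)).card ≤
        T.card * b := Finset.card_biUnion_le_card_mul _ _ _ fun i _ => by simp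
    have h5 := Finset.card_sdiff_add_card_eq_card hS
    rw [Int.card_Ico] at h1 h5
    have h6 : (a + (3 * l * b : ℕ) - (a + (2 * l * b : ℕ))).toNat = l * b := by
      have : 3 * l * b = 2 * l * b + l * b := by ring
      omega
    have h7 : (a + (5 * l * b : ℕ) - a).toNat = 5 * l * b := by omega
    omega
  have hcount' : (l : ℝ) * b + S.card ≤ 5 * l * b + 2 * cross.card + T.card * b := by
    exact_mod_cast hcount
  have hX : (0 : ℝ) ≤ cross.card := by positivity
  have h8 := mul_le_mul_of_nonneg_left hcount' (mul_nonneg hc hK)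
  have h9 := mul_le_mul_of_nonneg_right hcK hX
  push_cast
  nlinarith

/-- The lengths of the intervals that are used for `k + 2` steps, in terms of those for `k`. -/
def stepLength (L : ℕ → ℕ) : ℕ → ℕ
  | 0 => 16
  | s + 1 => 5 * L (stepLength L s) * stepLength L s

theorem stepLength_pos {L : ℕ → ℕ} (hL : ∀ s, 0 < L s) (s : ℕ) : 0 < stepLength L s := by
  induction s with
  | zero => simp [stepLength]
  | succ s ih =>
    rw [stepLength]
    have := hL (stepLength L s)
    positivity

theorem LinkBound.step {k : ℕ} {L : ℕ → ℕ} {c K : ℝ} (h : LinkBound k L c K)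
    (hL : ∀ s, 0 < L s) (hc : 0 ≤ c) (hK : 0 ≤ K) (hcK : c * K ≤ 1 / 2) :
    LinkBound (k + 2) (stepLength L) (c / 10) (5 * K) := by
  intro s
  induction s with
  | zero =>
    intro a R S _ _
    simp
  | succ s ih =>
    intro a R S hS hR
    rw [stepLength] at hS ⊢
    have hb := stepLength_pos hL s
    -- The pairs inside blocks contribute density `c / 10 * s`, the cross pairs the additional `c /
    -- 10`.
    have h1 := ih.blocks hb a (5 * L (stepLength L s)) R S hS hR
    have h2 := card_cross_ge hb hc hK hcK (h (stepLength L s)) hS hR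
    push_cast at h1 h2 ⊢
    linarith

/-! ### Growth of the Ackermann hierarchies -/

/-- A sequence of positive numbers that at least doubles in each step. -/
structure Doubling (f : ℕ → ℕ) : Prop where
  pos_zero : 0 < f 0
  double : ∀ n, 2 * f n ≤ f (n + 1)

namespace Doubling

variable {f : ℕ → ℕ}

theorem two_pow_mul_le (hf : Doubling f) (n d : ℕ) : 2 ^ d * f n ≤ f (n + d) := by
  induction d with
  | zero => simp
  | succ d ih =>
    have := hf.double (n + d)
    rw [pow_succ, ← add_assoc]
    linarith

theorem monotone (hf : Doubling f) : Monotone f :=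
  monotone_nat_of_le_succ fun n => by have := hf.double n; omega

theorem pos (hf : Doubling f) (n : ℕ) : 0 < f n :=
  hf.pos_zero.trans_le (hf.monotone n.zero_le)

theorem two_pow_le (hf : Doubling f) (n : ℕ) : 2 ^ n ≤ f n := by
  have h := hf.two_pow_mul_le 0 n
  rw [zero_add] at h
  exact (Nat.le_mul_of_pos_right _ hf.pos_zero).trans h

/-- Passing from `4 * x + 7` to `5 * x` leaves `x - 7` doublings, which absorb the factor `25 * x`
once `x ≥ 16`; hence the initial value of `stepLength`. -/
theorem mul_le (hf : Doubling f) {x : ℕ} (hx : 16 ≤ x) : 25 * x * f (4 * x + 7) ≤ f (5 * x) := by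
  have h : 25 * x ≤ 2 ^ (x - 7) := by
    induction x, hx using Nat.le_induction with
    | base => norm_num
    | succ x hx ih =>
      rw [show x + 1 - 7 = x - 7 + 1 by omega, pow_succ]
      omega
  calc 25 * x * f (4 * x + 7) ≤ 2 ^ (x - 7) * f (4 * x + 7) := Nat.mul_le_mul_right _ h
    _ ≤ f (4 * x + 7 + (x - 7)) := hf.two_pow_mul_le _ _
    _ = f (5 * x) := by congr 1; omega

end Doubling

/-- The common properties of the hierarchies `ackA` and `ackB`. -/
structure Hierarchy (F : ℕ → ℕ → ℕ) : Prop where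
  succ_succ : ∀ k n, F (k + 1) (n + 1) = F k (F (k + 1) n)
  exists_start : ∃ m, 0 < m ∧ (∀ k, F (k + 1) 0 = m) ∧ ∀ n, m ≤ n → 2 * n ≤ F 0 n

theorem Hierarchy.doubling {F : ℕ → ℕ → ℕ} (hF : Hierarchy F) (k : ℕ) : Doubling (F (k + 1)) := by
  obtain ⟨m, hm, h0, h2⟩ := hF.exists_start
  -- Doubling above the start value `m` passes up one level, because the values of the next level
  -- never drop below `m`.
  have key : ∀ k, (∀ n, m ≤ n → 2 * n ≤ F k n) → Doubling (F (k + 1)) := by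
    intro k hk
    have hge : ∀ n, m ≤ F (k + 1) n := by
      intro n
      induction n with
      | zero => rw [h0]
      | succ n ih =>
        rw [hF.succ_succ]
        have := hk _ ih
        omega
    exact ⟨by rw [h0]; exact hm, fun n => by rw [hF.succ_succ]; exact hk _ (hge n)⟩
  refine key k ?_
  induction k with
  | zero => exact h2
  | succ k ih =>
    intro n hn
    obtain ⟨d, rfl⟩ := Nat.exists_eq_succ_of_ne_zero (by omega : n ≠ 0)
    have h1 := (key k ih).two_pow_le (d + 1)
    have h3 := Nat.lt_two_pow_self (n := d)
    rw [pow_succ] at h1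
    simp only [Nat.succ_eq_add_one]
    omega

theorem hierarchy_ackA : Hierarchy ackA where
  succ_succ _ _ := by rw [ackA]
  exists_start := ⟨1, one_pos, fun _ => by rw [ackA], fun n _ => by rw [ackA]⟩

theorem hierarchy_ackB : Hierarchy ackB where
  succ_succ _ _ := by rw [ackB]
  exists_start := ⟨2, two_pos, fun _ => by rw [ackB], fun n hn => by rw [ackB]; nlinarith⟩

theorem sixteen_le_stepLength {L : ℕ → ℕ} (hL : ∀ s, 0 < L s) (s : ℕ) : 16 ≤ stepLength L s := by
  induction s with
  | zero => simp [stepLength]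
  | succ s ih =>
    rw [stepLength]
    exact ih.trans (Nat.le_mul_of_pos_left _ (by have := hL (stepLength L s); omega))

/-- The factor 5 on the left makes the induction close, since `mul_le` ends at `f (5 * x)`. The
shift 7 comes from `5 * 16 ≤ 2 ^ 7`. -/
theorem stepLength_le {L f g : ℕ → ℕ} (hf : Doubling f) (hg : Doubling g)
    (hgf : ∀ n, g (n + 1) = f (g n)) (hL : ∀ s, 0 < L s) (hLf : ∀ s, L s ≤ f (4 * s + 7))
    (s : ℕ) : 5 * stepLength L s ≤ g (s + 7) := by
  induction s with
  | zero =>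
    have := hg.two_pow_le 7
    rw [stepLength, zero_add]
    omega
  | succ s ih =>
    rw [stepLength, show s + 1 + 7 = s + 7 + 1 by ring, hgf]
    refine le_trans ?_ (hf.monotone ih)
    refine le_trans ?_ (hf.mul_le (sixteen_le_stepLength hL s))
    have := Nat.mul_le_mul_left (25 * stepLength L s) (hLf (stepLength L s))
    linarith

/-- The first level is a hypothesis because `stepLength_le` needs a doubling sequence below it, and
`F 0` need not be one. Each step halves `c * K`, so it stays at most `1/2`. -/
theorem Hierarchy.exists_linkBound {F : ℕ → ℕ → ℕ} (hF : Hierarchy F) {k : ℕ} {L : ℕ → ℕ}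
    (hL : ∀ s, 0 < L s) (hLF : ∀ s, stepLength L s ≤ F 1 (4 * s + 7))
    (h : LinkBound k L (1 / 4) 2) (j : ℕ) :
    ∃ L : ℕ → ℕ, (∀ s, 0 < L s) ∧ (∀ s, L s ≤ F (j + 1) (4 * s + 7)) ∧
      LinkBound (k + 2 * (j + 1)) L (1 / 4 / 10 ^ (j + 1)) (2 * 5 ^ (j + 1)) := by
  induction j with
  | zero =>
    refine ⟨stepLength L, stepLength_pos hL, hLF, ?_⟩
    have := h.step hL (by norm_num) (by norm_num) (by norm_num)
    norm_num at this ⊢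
    exact this
  | succ j ih =>
    obtain ⟨L', h1, h2, h3⟩ := ih
    refine ⟨stepLength L', stepLength_pos h1, fun s => ?_, ?_⟩
    · have h4 := stepLength_le (hF.doubling j) (hF.doubling (j + 1)) (hF.succ_succ (j + 1)) h1 h2 s
      have h5 := (hF.doubling (j + 1)).monotone (show s + 7 ≤ 4 * s + 7 by omega)
      omega
    · have h4 : (1 / 4 / 10 ^ (j + 1) : ℝ) * (2 * 5 ^ (j + 1)) ≤ 1 / 2 := by
        have h5 : (5 : ℝ) ^ (j + 1) ≤ 10 ^ (j + 1) := pow_le_pow_left₀ (by norm_num) (by norm_num) _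
        rw [div_mul_eq_mul_div, div_le_iff₀ (by positivity)]
        linarith
      have := h3.step h1 (by positivity) (by positivity) h4
      rwa [div_div _ _ (10 : ℝ), ← pow_succ, show 5 * (2 * (5 : ℝ) ^ (j + 1)) = 2 * 5 ^ (j + 1 + 1) by
        ring] at this

/-- The function inverted by `alpha k`. -/
def ack (k : ℕ) : ℕ → ℕ := if Even k then ackA (k / 2) else ackB (k / 2)

theorem le_ack_alpha (k n : ℕ) : n ≤ ack k (alpha k n) := by
  unfold ack alpha
  split_ifs
  · exact Nat.find_spec (exists_le_ackA (k / 2) n)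
  · exact Nat.find_spec (exists_le_ackB (k / 2) n)

theorem ack_lt_of_lt_alpha {k n t : ℕ} (h : t < alpha k n) : ack k t < n := by
  unfold ack
  unfold alpha at h
  split_ifs at h ⊢
  · exact not_le.1 (Nat.find_min (exists_le_ackA (k / 2) n) h)
  · exact not_le.1 (Nat.find_min (exists_le_ackB (k / 2) n) h)

/-- The lengths grow by the factor 10 per step, which is below `2 ^ 4`; this is the source of the
coefficient 4. -/
theorem stepLength_two_le (s : ℕ) : stepLength (fun _ => 2) s ≤ ackA 1 (4 * s + 7) := by
  have hA := hierarchy_ackA.doubling 0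
  induction s with
  | zero => exact le_trans (by norm_num [stepLength]) (hA.two_pow_le 7)
  | succ s ih =>
    have := hA.two_pow_mul_le (4 * s + 7) 4
    rw [zero_add] at this
    rw [stepLength, show 4 * (s + 1) + 7 = 4 * s + 7 + 4 by ring]
    omega

theorem stepLength_add_two_le (s : ℕ) :
    stepLength (fun s => s + 2) s ≤ ackB 1 (4 * s + 7) := by
  have hB := hierarchy_ackB.doubling 0
  have key : 15 * stepLength (fun s => s + 2) s ≤ ackB 1 (s + 7) := by
    induction s with
    | zero =>
      have := hB.two_pow_mul_le 0 7
      rw [show ackB (0 + 1) 0 = 2 by rw [ackB]] at this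
      rw [stepLength, zero_add]
      rw [zero_add, zero_add] at this
      omega
    | succ s ih =>
      have h16 := sixteen_le_stepLength (L := fun s => s + 2) (fun s => by omega) s
      rw [stepLength, show s + 1 + 7 = s + 7 + 1 by ring, ackB, ackB]
      rw [zero_add]
      nlinarith
  have := hB.monotone (show s + 7 ≤ 4 * s + 7 by omega)
  rw [zero_add] at this
  omega

theorem exists_linkBound {k : ℕ} (hk : 2 ≤ k) :
    ∃ (L : ℕ → ℕ) (K : ℝ), (∀ s, 0 < L s) ∧ (∀ s, L s ≤ ack k (4 * s + 7)) ∧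
      LinkBound k L (1 / 4 / 10 ^ (k / 2)) K := by
  obtain ⟨j, hj⟩ := Nat.exists_eq_add_of_le' (show 1 ≤ k / 2 by omega)
  unfold ack
  rw [hj]
  split_ifs with h
  · obtain ⟨L, h1, h2, h3⟩ := hierarchy_ackA.exists_linkBound (fun _ => two_pos)
      stepLength_two_le linkBound_zero j
    rw [show 0 + 2 * (j + 1) = k by have := Nat.even_iff.1 h; omega] at h3
    exact ⟨L, _, h1, h2, h3⟩
  · obtain ⟨L, h1, h2, h3⟩ := hierarchy_ackB.exists_linkBound (fun s => by omega)
      stepLength_add_two_le linkBound_one j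
    rw [show 1 + 2 * (j + 1) = k by have := Nat.not_even_iff.1 h; omega] at h3
    exact ⟨L, _, h1, h2, h3⟩

/-! ### From spanners to linked points, and the lower bound -/

section Walk

variable {V : Type*} [MetricSpace V] {H : SimpleGraph V} {p q : V}

theorem walkWeight_nil : walkWeight (SimpleGraph.Walk.nil : H.Walk p p) = 0 := by
  simp [walkWeight]

theorem walkWeight_cons {r : V} (h : H.Adj p r) (w : H.Walk r q) :
    walkWeight (SimpleGraph.Walk.cons h w) = dist p r + walkWeight w := by
  simp [walkWeight]

theorem dist_add_dist_le_walkWeight (w : H.Walk p q) {x : V} (hx : x ∈ w.support) :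
    dist p x + dist x q ≤ walkWeight w := by
  induction w generalizing x with
  | nil =>
    rw [SimpleGraph.Walk.support_nil, List.mem_singleton] at hx
    subst hx
    simp [walkWeight_nil]
  | @cons u v y h w ih =>
    rw [walkWeight_cons]
    rw [SimpleGraph.Walk.support_cons, List.mem_cons] at hx
    rcases hx with rfl | hx
    · have h1 := ih w.start_mem_support
      have h2 := dist_triangle x v y
      rw [dist_self] at h1 ⊢
      linarith
    · have h1 := ih hx
      have h2 := dist_triangle u v x
      linarith

end Walk

theorem hop_of_walk {V : Type*} {H : SimpleGraph V} {p q : V} (P : V → Prop)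
    (w : H.Walk p q) (hP : ∀ x ∈ w.support, P x) :
    Hop (fun x y => H.Adj x y ∧ P x ∧ P y) w.length p q := by
  induction w with
  | nil => rfl
  | @cons u v y h w ih =>
    simp only [SimpleGraph.Walk.support_cons, List.mem_cons, forall_eq_or_imp] at hP
    exact ⟨v, Or.inr ⟨h, hP.1, hP.2 v w.start_mem_support⟩, ih hP.2⟩

theorem IsSpanner.locallyLinked {n k : ℕ} {ε : ℝ} (hε : ε ≤ 1 / 2) {H : SimpleGraph ℤ}
    (h : IsSpanner (uniformLine n) (1 + ε) k H) {S : Finset ℤ}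
    (hS : ∀ p ∈ S, p ∈ uniformLine n) : LocallyLinked H.Adj S k := by
  intro p hp q hq hpq
  obtain ⟨w, hw, hlen⟩ := h p (hS p hp) q (hS q hq) hpq.ne
  refine (hop_of_walk (Near p q) w fun x hx => ?_).of_le hlen
  have h1 := (dist_add_dist_le_walkWeight w hx).trans hw
  have hpq' : (p : ℝ) + 1 ≤ q := by exact_mod_cast hpq
  rw [Int.dist_eq, Int.dist_eq, Int.dist_eq, abs_sub_comm (p : ℝ) q,
    abs_of_pos (show (0 : ℝ) < q - p by linarith)] at h1
  have h2 : (1 + ε) * ((q : ℝ) - p) ≤ 3 / 2 * (q - p) :=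
    mul_le_mul_of_nonneg_right (by linarith) (by linarith)
  have h3 := le_abs_self ((p : ℝ) - x)
  have h4 := neg_abs_le ((p : ℝ) - x)
  have h5 := le_abs_self ((x : ℝ) - q)
  have h6 := neg_abs_le ((x : ℝ) - q)
  constructor
  · have : 2 * (p : ℝ) - q - 2 ≤ x := by linarith
    exact_mod_cast this
  · have : (x : ℝ) ≤ 2 * q - p + 2 := by linarith
    exact_mod_cast this

theorem card_le_two_mul_ncard_edgeSet {H : SimpleGraph ℤ} (hH : H.edgeSet.Finite)
    {D : Finset (ℤ × ℤ)} (hD : ∀ e ∈ D, H.Adj e.1 e.2) : D.card ≤ 2 * H.edgeSet.ncard := by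
  classical
  rw [Set.ncard_eq_toFinset_card _ hH]
  refine Finset.card_le_mul_card_image_of_maps_to (f := fun e => s(e.1, e.2)) ?_ 2 ?_
  · intro e he
    simpa using hD e he
  · intro z _
    induction z using Sym2.ind with
    | _ x y =>
      refine (Finset.card_le_card (t := {(x, y), (y, x)}) ?_).trans Finset.card_le_two
      intro e he
      have := (Finset.mem_filter.1 he).2
      rw [Sym2.eq_iff] at this
      rw [Finset.mem_insert, Finset.mem_singleton, Prod.ext_iff, Prod.ext_iff]
      exact this

theorem IsSpanner.le_two_mul_ncard {n k : ℕ} (hn : 2 ≤ n) {t : ℝ} {H : SimpleGraph ℤ}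
    (hH : H.edgeSet.Finite) (h : IsSpanner (uniformLine n) t k H) :
    n ≤ 2 * H.edgeSet.ncard := by
  have hnb : ∀ p ∈ Finset.Icc 1 (n : ℤ), ∃ r, H.Adj p r := by
    intro p hp
    rw [Finset.mem_Icc] at hp
    obtain ⟨q, hq1, hq2, hne⟩ : ∃ q : ℤ, 1 ≤ q ∧ q ≤ n ∧ p ≠ q := by
      rcases eq_or_ne p 1 with rfl | hp1
      · exact ⟨2, by omega, by omega, by omega⟩
      · exact ⟨1, by omega, by omega, hp1⟩
    obtain ⟨w, -, -⟩ := h p hp q ⟨hq1, hq2⟩ hne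
    cases w with
    | nil => exact absurd rfl hne
    | cons h _ => exact ⟨_, h⟩
  choose! f hf using hnb
  have := card_le_two_mul_ncard_edgeSet hH (D := (Finset.Icc 1 (n : ℤ)).image fun p => (p, f p))
    (by
      intro e he
      obtain ⟨p, hp, rfl⟩ := Finset.mem_image.1 he
      exact hf p hp)
  rwa [Finset.card_image_of_injective _ fun p q h => (Prod.ext_iff.1 h).1, Int.card_Icc,
    show ((n : ℤ) + 1 - 1).toNat = n by omega] at this

theorem alpha_one {k : ℕ} (hk : 2 ≤ k) : alpha k 1 = 0 := by
  by_contra h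
  have h1 := ack_lt_of_lt_alpha (Nat.pos_of_ne_zero h)
  obtain ⟨j, hj⟩ := Nat.exists_eq_add_of_le' (show 1 ≤ k / 2 by omega)
  unfold ack at h1
  rw [hj] at h1
  split_ifs at h1 <;> simp [ackA, ackB] at h1

theorem IsSpanner.ncard_ge {n k : ℕ} (hn : 1 ≤ n) (hk : 2 ≤ k) {ε : ℝ} (hε : ε ≤ 1 / 2)
    {H : SimpleGraph ℤ} (hH : H.edgeSet.Finite) (h : IsSpanner (uniformLine n) (1 + ε) k H) :
    1 / 256 * ((n : ℝ) / 2 ^ (6 * (k / 2)) * alpha k n) ≤ H.edgeSet.ncard := by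
  have hpow : (10 : ℝ) ^ (k / 2) ≤ 2 ^ (6 * (k / 2)) := by
    rw [pow_mul]
    exact pow_le_pow_left₀ (by norm_num) (by norm_num) _
  have hpow1 : (1 : ℝ) ≤ 10 ^ (k / 2) := one_le_pow₀ (by norm_num)
  have hle : (n : ℝ) / 2 ^ (6 * (k / 2)) ≤ n / 10 ^ (k / 2) := by gcongr
  have hle' := mul_le_mul_of_nonneg_right hle (Nat.cast_nonneg (α := ℝ) (alpha k n))
  rcases hn.eq_or_lt with rfl | hn
  · rw [alpha_one hk]
    simp
  -- For small `alpha` it suffices that no point is isolated.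
  rcases le_or_gt (alpha k n) 21 with ha | ha
  · have h1 : (n : ℝ) ≤ 2 * H.edgeSet.ncard := by exact_mod_cast h.le_two_mul_ncard hn hH
    have h2 : (alpha k n : ℝ) ≤ 21 := by exact_mod_cast ha
    have h3 : (n : ℝ) / 10 ^ (k / 2) ≤ n := div_le_self (by positivity) hpow1
    have h4 := mul_le_mul h3 h2 (by positivity) (by positivity)
    linarith
  · obtain ⟨L, K, hL, hLa, hLB⟩ := exists_linkBound hk
    -- The largest `s` with `4 * s + 7 < alpha k n` (up to one unit in `alpha`), so that `L s < n`
    -- and blocks of length `L s` cover at least half of the points.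
    set s := (alpha k n - 8) / 4 with hs
    have hLn : L s < n := (hLa s).trans_lt (ack_lt_of_lt_alpha (by omega))
    set m := n / L s with hm
    have hmn : m * L s ≤ n := Nat.div_mul_le_self _ _
    have hmn2 : n ≤ 2 * (m * L s) := by
      have h1 := Nat.div_add_mod' n (L s)
      have h2 := Nat.mod_lt n (hL s)
      have h3 : 1 * L s ≤ m * L s := Nat.mul_le_mul_right _
        ((Nat.one_le_div_iff (hL s)).2 hLn.le)
      rw [← hm] at h1
      omega
    have h1 := (hLB s).blocks (hL s) 1 m H.Adj (Finset.Ico 1 (1 + (m * L s : ℕ)))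
      subset_rfl (h.locallyLinked hε (fun p hp => by
        rw [Finset.mem_Ico] at hp
        have : ((m * L s : ℕ) : ℤ) ≤ n := by exact_mod_cast hmn
        exact ⟨hp.1, by omega⟩))
    have h2 := card_le_two_mul_ncard_edgeSet hH (D := relPairs H.Adj 1 (m * L s))
      fun e he => (mem_relPairs.1 he).2
    rw [Int.card_Ico, show ((1 : ℤ) + (m * L s : ℕ) - 1).toNat = m * L s by omega, sub_self,
      mul_zero, sub_zero] at h1
    have h3 : (n : ℝ) ≤ 2 * (m * L s : ℕ) := by exact_mod_cast hmn2
    have h4 : (alpha k n : ℝ) ≤ 16 * s := by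
      have : alpha k n ≤ 16 * s := by omega
      exact_mod_cast this
    have h5 : ((relPairs H.Adj 1 (m * L s)).card : ℝ) ≤ 2 * H.edgeSet.ncard := by exact_mod_cast h2
    have h6 := mul_le_mul h3 h4 (by positivity) (by positivity)
    have h7 : (n : ℝ) / 10 ^ (k / 2) * alpha k n ≤
        2 * (m * L s : ℕ) * (16 * s) / 10 ^ (k / 2) := by
      rw [div_mul_eq_mul_div]
      gcongr
    have h8 : (1 / 4 / 10 ^ (k / 2) * (s : ℝ) * (m * L s : ℕ)) =
        1 / 128 * (2 * (m * L s : ℕ) * (16 * s) / 10 ^ (k / 2)) := by ring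
    rw [h8] at h1
    have h9 : (0 : ℝ) ≤ ((relPairs H.Adj 1 (m * L s)).filter
      fun e => blockIndex 1 (L s) e.1 ≠ blockIndex 1 (L s) e.2).card := by positivity
    linarith

/-! ### The construction for the upper bound -/

/-- There is a set of at most `m` increasing edges on `0, …, n - 1` by which any two points are
joined monotonically in at most `k` steps. -/
def HasHopGraph (k n m : ℕ) : Prop :=
  ∃ E : Finset (ℕ × ℕ), E.card ≤ m ∧ (∀ e ∈ E, e.1 < e.2 ∧ e.2 < n) ∧
    ∀ p q, p < q → q < n → Hop (fun x y => (x, y) ∈ E) k p q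

theorem HasHopGraph.mono {k k' n m m' : ℕ} (h : HasHopGraph k n m) (hk : k ≤ k') (hm : m ≤ m') :
    HasHopGraph k' n m' := by
  obtain ⟨E, h1, h2, h3⟩ := h
  exact ⟨E, h1.trans hm, h2, fun p q hpq hq => (h3 p q hpq hq).of_le hk⟩

theorem hasHopGraph_one (n : ℕ) : HasHopGraph 1 n (n * n) := by
  refine ⟨(Finset.range n ×ˢ Finset.range n).filter fun e => e.1 < e.2, ?_, ?_, ?_⟩
  · exact (Finset.card_filter_le _ _).trans (by simp)
  · intro e he
    simp only [Finset.mem_filter, Finset.mem_product, Finset.mem_range] at he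
    exact ⟨he.2, he.1.2⟩
  · intro p q hpq hq
    refine Hop.single (Or.inr ?_)
    simp only [Finset.mem_filter, Finset.mem_product, Finset.mem_range]
    omega

theorem hasHopGraph_zero {n : ℕ} (hn : n ≤ 1) : HasHopGraph 0 n 0 :=
  ⟨∅, le_rfl, by simp, fun p q hpq hq => by omega⟩

/-- Graphs on consecutive blocks of length `b` together link the points within the blocks. -/
theorem exists_blockGraph {k b d : ℕ} (h : ∀ r ≤ b, HasHopGraph k r (d * r)) (m : ℕ) :
    ∀ n ≤ m * b, ∃ E : Finset (ℕ × ℕ), E.card ≤ d * n ∧ (∀ e ∈ E, e.1 < e.2 ∧ e.2 < n) ∧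
      ∀ p q, p < q → q < n → p / b = q / b → Hop (fun x y => (x, y) ∈ E) k p q := by
  induction m with
  | zero =>
    intro n hn
    exact ⟨∅, by simp, by simp, fun p q _ hq => by omega⟩
  | succ m ih =>
    intro n hn
    rw [add_mul, one_mul] at hn
    rcases le_or_gt n (m * b) with hnm | hnm
    · exact ih n hnm
    obtain ⟨r, rfl⟩ := Nat.exists_eq_add_of_lt hnm
    rw [add_assoc] at hn hnm ⊢
    obtain ⟨E, h1, h2, h3⟩ := ih (m * b) le_rfl
    obtain ⟨E', h1', h2', h3'⟩ := h (r + 1) (by omega)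
    have hb : 0 < b := by omega
    refine ⟨E ∪ E'.image fun e => (m * b + e.1, m * b + e.2), ?_, ?_, ?_⟩
    · have h4 := Finset.card_union_le E (E'.image fun e => (m * b + e.1, m * b + e.2))
      have h5 : (E'.image fun e => (m * b + e.1, m * b + e.2)).card ≤ E'.card :=
        Finset.card_image_le
      rw [mul_add]
      omega
    · intro e he
      rcases Finset.mem_union.1 he with he | he
      · have := h2 e he
        omega
      · obtain ⟨f, hf, rfl⟩ := Finset.mem_image.1 he
        have := h2' f hf
        dsimp only
        omega
    · intro p q hpq hq hblock
      rcases lt_or_ge q (m * b) with hqm | hqm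
      · exact (h3 p q hpq hqm hblock).mono fun x y hxy => Finset.mem_union_left _ hxy
      · have hpm : m * b ≤ p := by
          rw [← Nat.le_div_iff_mul_le hb, hblock, Nat.le_div_iff_mul_le hb]
          exact hqm
        obtain ⟨p, rfl⟩ := Nat.exists_eq_add_of_le hpm
        obtain ⟨q, rfl⟩ := Nat.exists_eq_add_of_le hqm
        refine (h3' p q (by omega) (by omega)).map (fun x => m * b + x) fun x y hxy => Or.inr ?_
        exact Finset.mem_union_right _ (Finset.mem_image.2 ⟨(x, y), hxy, rfl⟩)

/-- The cut points are the positive multiples of `b` below `n`. A path between blocks goes right to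
the next cut, along at most `k` edges between cuts, then from the last cut to its goal. The cut 0 is
never needed, whence `(n - 1) / b`. -/
theorem HasHopGraph.step {k n b d m : ℕ} (hb : 0 < b)
    (hblock : ∀ r ≤ b, HasHopGraph (k + 2) r (d * r)) (hcut : HasHopGraph k ((n - 1) / b) m) :
    HasHopGraph (k + 2) n (d * n + m + 2 * n) := by
  obtain ⟨E, h1, h2, h3⟩ := exists_blockGraph hblock n n (Nat.le_mul_of_pos_right _ hb)
  obtain ⟨D, h1', h2', h3'⟩ := hcut
  set right := (Finset.range n).image fun p => (p, (p / b + 1) * b) with hright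
  set left := (Finset.range n).image fun q => (q / b * b, q) with hleft
  set cut := D.image fun e => ((e.1 + 1) * b, (e.2 + 1) * b) with hcut
  refine ⟨E ∪ cut ∪ (right ∪ left).filter fun e => e.1 < e.2 ∧ e.2 < n, ?_, ?_, ?_⟩
  · have h4 := Finset.card_union_le (E ∪ cut) ((right ∪ left).filter fun e => e.1 < e.2 ∧ e.2 < n)
    have h5 := Finset.card_union_le E cut
    have h6 := Finset.card_filter_le (right ∪ left) fun e => e.1 < e.2 ∧ e.2 < n
    have h7 := Finset.card_union_le right left
    have h8 : cut.card ≤ D.card := Finset.card_image_le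
    have h9 : right.card ≤ (Finset.range n).card := Finset.card_image_le
    have h10 : left.card ≤ (Finset.range n).card := Finset.card_image_le
    rw [Finset.card_range] at h9 h10
    omega
  · intro e he
    rcases Finset.mem_union.1 he with he | he
    · rcases Finset.mem_union.1 he with he | he
      · exact h2 e he
      · obtain ⟨f, hf, rfl⟩ := Finset.mem_image.1 he
        obtain ⟨h4, h5⟩ := h2' f hf
        refine ⟨Nat.mul_lt_mul_of_pos_right (by omega) hb, ?_⟩
        have h6 : (f.2 + 1) * b ≤ n - 1 := (Nat.le_div_iff_mul_le hb).1 h5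
        have h7 : 0 < (f.2 + 1) * b := by positivity
        dsimp only
        omega
    · exact (Finset.mem_filter.1 he).2
  · intro p q hpq hq
    rcases (Nat.div_le_div_right (c := b) hpq.le).eq_or_lt with hij | hij
    · exact (h3 p q hpq hq hij).mono fun x y hxy =>
        Finset.mem_union_left _ (Finset.mem_union_left _ hxy)
    have hqb : q / b * b ≤ q := Nat.div_mul_le_self q b
    have hpb : p < (p / b + 1) * b := by
      rw [mul_comm]
      exact Nat.lt_mul_div_succ p hb
    have hpq' : (p / b + 1) * b ≤ q / b * b := Nat.mul_le_mul_right _ hij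
    obtain ⟨j, hj⟩ := Nat.exists_eq_add_of_le' (Nat.one_le_of_lt hij)
    have hmid : Hop (fun x y => (x, y) ∈ E ∪ cut ∪
        (right ∪ left).filter fun e => e.1 < e.2 ∧ e.2 < n) k ((p / b + 1) * b) (q / b * b) := by
      rw [hj]
      rcases (show p / b ≤ j by omega).eq_or_lt with hpj | hpj
      · rw [hpj]
        exact Hop.refl _ _
      · have hjn : j < (n - 1) / b := by
          rw [← Nat.add_one_le_iff, ← hj, Nat.le_div_iff_mul_le hb]
          omega
        refine (h3' _ _ hpj hjn).map (fun t => (t + 1) * b) fun x y hxy => Or.inr ?_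
        exact Finset.mem_union_left _ (Finset.mem_union_right _
          (Finset.mem_image.2 ⟨(x, y), hxy, rfl⟩))
    refine ⟨_, Or.inr ?_, hmid.trans (Hop.single ?_)⟩
    · refine Finset.mem_union_right _ (Finset.mem_filter.2 ⟨Finset.mem_union_left _
        (Finset.mem_image.2 ⟨p, Finset.mem_range.2 (by omega), rfl⟩), hpb, ?_⟩)
      dsimp only
      omega
    · rcases hqb.eq_or_lt with h | h
      · exact Or.inl h
      · exact Or.inr (Finset.mem_union_right _ (Finset.mem_filter.2 ⟨Finset.mem_union_right _
          (Finset.mem_image.2 ⟨q, Finset.mem_range.2 hq, rfl⟩), h, hq⟩))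

/-- Intervals of length at most `G s` have `k`-hop graphs with `C * (s + 1)` edges per point. -/
def HopBound (k : ℕ) (G : ℕ → ℕ) (C : ℕ) : Prop :=
  ∀ s n, n ≤ G s → HasHopGraph k n (C * (s + 1) * n)

/-- With blocks of length `b = G' s`, the graph on the roughly `n / b` cuts may afford `C * (b + 1)`
edges per cut, which is only `2 * C` per point; each level thus adds at most `2 * C + 2`. -/
theorem HopBound.step {k C : ℕ} {G G' : ℕ → ℕ} (h : HopBound k G C) (h0 : G' 0 ≤ 2)
    (hpos : ∀ s, 0 < G' s) (hG : ∀ s n, n ≤ G' (s + 1) → (n - 1) / G' s ≤ G (G' s)) :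
    HopBound (k + 2) G' (2 * C + 2) := by
  intro s
  induction s with
  | zero =>
    intro n hn
    have : n * n ≤ 2 * n := Nat.mul_le_mul_right _ (hn.trans h0)
    exact (hasHopGraph_one n).mono (by omega) (by nlinarith)
  | succ s ih =>
    intro n hn
    have hb := hpos s
    have h1 := HasHopGraph.step hb ih (h (G' s) ((n - 1) / G' s) (hG s n hn))
    refine h1.mono le_rfl ?_
    have h2 : (n - 1) / G' s * G' s ≤ n := (Nat.div_mul_le_self _ _).trans (Nat.sub_le _ _)
    have h3 : (G' s + 1) * ((n - 1) / G' s) ≤ 2 * n := by nlinarith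
    have h4 := Nat.mul_le_mul_left C h3
    nlinarith

theorem hopBound_zero : HopBound 0 (fun _ => 1) 0 := fun _ _ hn =>
  (hasHopGraph_zero hn).mono le_rfl (Nat.zero_le _)

theorem hopBound_one : HopBound 1 (fun s => s) 1 := fun s n hn =>
  (hasHopGraph_one n).mono le_rfl
    (Nat.mul_le_mul_right _ (by rw [one_mul]; exact Nat.le_succ_of_le hn))

theorem Hierarchy.exists_hopBound {F : ℕ → ℕ → ℕ} (hF : Hierarchy F) (h0 : ∀ j, F (j + 1) 0 ≤ 2)
    {k C : ℕ} {G : ℕ → ℕ} (h : HopBound k G C)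
    (hG : ∀ s n, n ≤ F 1 (s + 1) → (n - 1) / F 1 s ≤ G (F 1 s)) (j : ℕ) :
    ∃ C, HopBound (k + 2 * (j + 1)) (F (j + 1)) C := by
  induction j with
  | zero => exact ⟨_, h.step (h0 0) (hF.doubling 0).pos hG⟩
  | succ j ih =>
    obtain ⟨C', hC'⟩ := ih
    refine ⟨_, hC'.step (h0 _) (hF.doubling _).pos fun s n hn => ?_⟩
    rw [hF.succ_succ] at hn
    exact (Nat.div_le_self _ _).trans ((Nat.sub_le _ _).trans hn)

theorem exists_hopBound {k : ℕ} (hk : 2 ≤ k) : ∃ C, HopBound k (ack k) C := by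
  obtain ⟨j, hj⟩ := Nat.exists_eq_add_of_le' (show 1 ≤ k / 2 by omega)
  unfold ack
  rw [hj]
  split_ifs with h
  · have := hierarchy_ackA.exists_hopBound (fun j => by rw [ackA]; omega) hopBound_zero
      -- At most two blocks leave a single cut point, which needs no edges; counting cuts by `n - 1`
      -- is essential here.
      (fun s n hn => by
        rw [ackA, ackA] at hn
        have := (hierarchy_ackA.doubling 0).pos s
        rw [zero_add] at this hn
        rw [← Nat.lt_add_one_iff, Nat.div_lt_iff_lt_mul this]
        omega) j
    rwa [show 0 + 2 * (j + 1) = k by have := Nat.even_iff.1 h; omega] at this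
  · have := hierarchy_ackB.exists_hopBound (fun j => by rw [ackB]) hopBound_one
      -- Here there are at most `b` cuts, so joining all of them directly costs order `b` per cut.
      (fun s n hn => by
        rw [ackB, ackB] at hn
        have := (hierarchy_ackB.doubling 0).pos s
        rw [zero_add] at this
        refine (Nat.div_le_div_right ((Nat.sub_le _ _).trans hn)).trans ?_
        rw [zero_add, sq, Nat.mul_div_cancel _ this]) j
    rwa [show 1 + 2 * (j + 1) = k by have := Nat.not_even_iff.1 h; omega] at this

/-! ### From monotone hop graphs to 1-spanners -/

theorem exists_walk_of_hop {H : SimpleGraph ℤ} {R : ℤ → ℤ → Prop}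
    (hR : ∀ x y, R x y → H.Adj x y ∧ x < y) {k : ℕ} {p q : ℤ} (h : Hop R k p q) :
    p ≤ q ∧ ∃ w : H.Walk p q, walkWeight w = q - p ∧ w.length ≤ k := by
  induction k generalizing p with
  | zero =>
    cases h
    exact ⟨le_rfl, .nil, by simp [walkWeight_nil], by simp⟩
  | succ k ih =>
    obtain ⟨r, h1, h2⟩ := h
    obtain ⟨hle, w, hw, hlen⟩ := ih h2
    rcases h1 with rfl | h1
    · exact ⟨hle, w, hw, by omega⟩
    · obtain ⟨hadj, hlt⟩ := hR _ _ h1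
      refine ⟨hlt.le.trans hle, .cons hadj w, ?_, by simpa using hlen⟩
      have : (p : ℝ) < r := by exact_mod_cast hlt
      rw [walkWeight_cons, hw, Int.dist_eq, abs_sub_comm, abs_of_pos (by linarith)]
      ring

theorem walkWeight_reverse {V : Type*} [MetricSpace V] {H : SimpleGraph V} {p q : V}
    (w : H.Walk p q) : walkWeight w.reverse = walkWeight w := by
  unfold walkWeight
  rw [SimpleGraph.Walk.darts_reverse, List.map_reverse, List.sum_reverse, List.map_map]
  congr 2
  ext d
  exact dist_comm _ _

theorem HasHopGraph.exists_spanner {k n m : ℕ} (h : HasHopGraph k n m) :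
    ∃ H : SimpleGraph ℤ, (∀ a b : ℤ, H.Adj a b → a ∈ uniformLine n ∧ b ∈ uniformLine n) ∧
      H.edgeSet.Finite ∧ IsSpanner (uniformLine n) 1 k H ∧ H.edgeSet.ncard ≤ m := by
  obtain ⟨E, h1, h2, h3⟩ := h
  set R : ℤ → ℤ → Prop := fun a b => ∃ e ∈ E, (e.1 : ℤ) + 1 = a ∧ (e.2 : ℤ) + 1 = b with hRdef
  have hR : ∀ a b, R a b → a < b ∧ a ∈ uniformLine n ∧ b ∈ uniformLine n := by
    rintro a b ⟨e, he, rfl, rfl⟩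
    have := h2 e he
    refine ⟨by omega, ⟨by omega, by omega⟩, by omega, by omega⟩
  set H := SimpleGraph.fromRel R with hH
  have hadj : ∀ a b, R a b → H.Adj a b := fun a b hab =>
    (SimpleGraph.fromRel_adj R a b).2 ⟨(hR a b hab).1.ne, Or.inl hab⟩
  have hedge : H.edgeSet ⊆ (E.image fun e => s((e.1 : ℤ) + 1, (e.2 : ℤ) + 1) : Finset (Sym2 ℤ)) := by
    intro z hz
    induction z using Sym2.ind with
    | _ x y =>
      rw [SimpleGraph.mem_edgeSet, SimpleGraph.fromRel_adj] at hz
      rw [Finset.mem_coe, Finset.mem_image]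
      rcases hz.2 with ⟨e, he, rfl, rfl⟩ | ⟨e, he, rfl, rfl⟩
      · exact ⟨e, he, rfl⟩
      · exact ⟨e, he, Sym2.eq_swap⟩
  have hwalk : ∀ p ∈ uniformLine n, ∀ q ∈ uniformLine n, p < q →
      ∃ w : H.Walk p q, walkWeight w = q - p ∧ w.length ≤ k := by
    intro p hp q hq hpq
    obtain ⟨p, rfl⟩ : ∃ p' : ℕ, p = p' + 1 := ⟨(p - 1).toNat, by have := hp.1; omega⟩
    obtain ⟨q, rfl⟩ : ∃ q' : ℕ, q = q' + 1 := ⟨(q - 1).toNat, by have := hq.1; omega⟩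
    have hq2 := hq.2
    have hhop := (h3 p q (by omega) (by omega)).map (R' := R) (fun x : ℕ => (x : ℤ) + 1)
      fun x y hxy => Or.inr ⟨(x, y), hxy, rfl, rfl⟩
    exact (exists_walk_of_hop (fun x y hxy => ⟨hadj x y hxy, (hR x y hxy).1⟩) hhop).2
  refine ⟨H, ?_, (Finset.finite_toSet _).subset hedge, ?_, ?_⟩
  · intro a b hab
    rcases ((SimpleGraph.fromRel_adj R a b).1 hab).2 with h | h
    · exact (hR a b h).2
    · exact (hR b a h).2.symm
  · intro p hp q hq hne
    rcases lt_or_gt_of_ne hne with hlt | hlt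
    · obtain ⟨w, hw, hlen⟩ := hwalk p hp q hq hlt
      have : (p : ℝ) < q := by exact_mod_cast hlt
      refine ⟨w, ?_, hlen⟩
      rw [hw, Int.dist_eq, abs_sub_comm, abs_of_pos (by linarith), one_mul]
    · obtain ⟨w, hw, hlen⟩ := hwalk q hq p hp hlt
      have : (q : ℝ) < p := by exact_mod_cast hlt
      refine ⟨w.reverse, ?_, by simpa using hlen⟩
      rw [walkWeight_reverse, hw, Int.dist_eq, abs_of_pos (by linarith), one_mul]
  · have h4 := Set.ncard_le_ncard hedge (Finset.finite_toSet _)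
    rw [Set.ncard_coe_finset] at h4
    exact h4.trans (Finset.card_image_le.trans h1)

theorem alpha_pos {k n : ℕ} (hk : 2 ≤ k) (hn : 3 ≤ n) : 0 < alpha k n := by
  by_contra h
  have h1 := le_ack_alpha k n
  rw [Nat.eq_zero_of_not_pos h] at h1
  obtain ⟨j, hj⟩ := Nat.exists_eq_add_of_le' (show 1 ≤ k / 2 by omega)
  unfold ack at h1
  rw [hj] at h1
  split_ifs at h1
  · rw [ackA] at h1
    omega
  · rw [ackB] at h1
    omega

end HopSpanner

theorem theorem1 :
    (∃ c : ℝ, 0 < c ∧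
      ∀ n : ℕ, 1 ≤ n → ∀ k : ℕ, 2 ≤ k → ∀ ε : ℝ, 0 ≤ ε → ε ≤ 1 / 2 →
        ∀ H : SimpleGraph ℤ, H.edgeSet.Finite →
          HopSpanner.IsSpanner (HopSpanner.uniformLine n) (1 + ε) k H →
            c * ((n : ℝ) / 2 ^ (6 * (k / 2)) * (HopSpanner.alpha k n : ℝ)) ≤
              (H.edgeSet.ncard : ℝ)) ∧
    (∀ k : ℕ, 2 ≤ k → ∃ C : ℝ, 0 < C ∧
      ∀ n : ℕ, 3 ≤ n →
        ∃ H : SimpleGraph ℤ,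
          (∀ a b : ℤ, H.Adj a b →
            a ∈ HopSpanner.uniformLine n ∧ b ∈ HopSpanner.uniformLine n) ∧
          H.edgeSet.Finite ∧
          HopSpanner.IsSpanner (HopSpanner.uniformLine n) 1 k H ∧
          (H.edgeSet.ncard : ℝ) ≤ C * ((n : ℝ) * (HopSpanner.alpha k n : ℝ))) := by
  refine ⟨⟨1 / 256, by norm_num, fun n hn k hk ε _ hε H hH h => h.ncard_ge hn hk hε hH⟩, ?_⟩
  intro k hk
  obtain ⟨C, hC⟩ := HopSpanner.exists_hopBound hk
  refine ⟨2 * C + 1, by positivity, fun n hn => ?_⟩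
  obtain ⟨H, h1, h2, h3, h4⟩ :=
    (hC (HopSpanner.alpha k n) n (HopSpanner.le_ack_alpha k n)).exists_spanner
  refine ⟨H, h1, h2, h3, ?_⟩
  have ha := HopSpanner.alpha_pos hk hn
  -- Since `alpha k n ≥ 1` for `n ≥ 3`, the summand 1 is absorbed by doubling `C`.
  have h5 : C * (HopSpanner.alpha k n + 1) * n ≤ (2 * C + 1) * (n * HopSpanner.alpha k n) := by
    have : C * (HopSpanner.alpha k n + 1) ≤ (2 * C + 1) * HopSpanner.alpha k n := by nlinarith
    calc _ ≤ (2 * C + 1) * HopSpanner.alpha k n * n := Nat.mul_le_mul_right _ this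
      _ = _ := by ring
  exact_mod_cast h4.trans h5
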